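/- For a lattice $\Lambda=\omega_1\mathbb Z\oplus\omega_2\mathbb Z\subset\mathbb C$ of rank 2 (with $\omega_1,\omega_2$ linearly independent over $\mathbb R$), $\mathbb C/\Lambda$ is an elliptic curve; an isomorphism $\mathbb C/\Lambda\to\mathbb C/\Lambda'$ is a biholomorphic group isomorphism. For $\tau\in\mathbb H$ let $\Lambda_\tau=\mathbb Z\oplus\tau\mathbb Z$. A (continuous) family of elliptic curves over a topological space $U$ is a disjoint union $E=\bigsqcup_{u\in U}E_u$ of elliptic curves $E_u=\mathbb C/\Lambda_u$ with a topology for which $E\to U$ is continuous and such that every point of $U$ has an open neighbourhood $V$, a continuous map $\tau:V\to\mathbb H$ and isomorphisms $\mathbb C/\Lambda_{\tau(v)}\cong E_v$ $(v\in V)$ for which the induced map $V\times\mathbb C\to E$ is continuous and open. Two families over $U$ are isomorphic if there is a homeomorphism between them over $U$ that restricts to an isomorphism of elliptic curves on each fibre. Let $\mathcal F_{ell}(U)$ be the set of isomorphism classes of families over $U$; with pullback of families this is a functor $\mathcal F_{ell}:Top^{op}\to Sets$. Give $\mathbb H/PSL_2(\mathbb Z)$ the quotient topology. **Claim.** The functor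 $\mathcal F_{ell}$ is not representable by $\mathbb H/PSL_2(\mathbb Z)$, that is, $\mathcal F_{ell}\not\cong Mor_{Top}(-,\mathbb H/PSL_2(\mathbb Z))$. Moreover, there are two families $\mathcal E',\mathcal E$ over the circle $\mathbb S^1=\mathbb R/\mathbb Z$ with all fibres equal to $\mathbb C/\Lambda_i$, obtained from the constant family $[0,1]\times\mathbb C/\Lambda_i$ by gluing the fibre over $1$ to the fibre over $0$ by the identity (for $\mathcal E'$) and by multiplication by $i$ (for $\mathcal E$), such that: 1. $\mathcal E$ and $\mathcal E'$ are not isomorphic; 2. $\mathcal E$ and $\mathcal E'$ have the same classifying map: for each of them the only continuous map $c:\mathbb S^1\to\mathbb H/PSL_2(\mathbb Z)$ that sends every $s$ to the class $[\tau]$ of some $\tau\in\mathbb H$ for which the fibre over $s$ is isomorphic to $\mathbb C/\Lambda_\tau$ is the constant map with value $[i]$; 3. every natural transformation $\mathcal F_{ell}\to Mor_{Top}(-,\mathbb H/PSL_2(\mathbb Z))$ sends $[\mathcal E]$ and $[\mathcal E']$ to the same map, and this map is constant. -/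

import Mathlib

open CategoryTheory UpperHalfPlane Topology
open scoped MatrixGroups

noncomputable section

namespace EllModuli

/-! ### Lattices, elliptic curves and their isomorphisms -/

/-- A lattice of full rank in `ℂ`: a subgroup `ω₁ ℤ ⊕ ω₂ ℤ` with `ω₁, ω₂` linearly independent
over `ℝ`. -/
structure ComplexLattice where
  carrier : AddSubgroup ℂ
  exists_basis : ∃ ω₁ ω₂ : ℂ, LinearIndependent ℝ ![ω₁, ω₂] ∧
    carrier = AddSubgroup.closure {ω₁, ω₂}

/-- The elliptic curve `ℂ / Λ`, with its group structure and its quotient topology. -/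
abbrev ComplexLattice.Curve (Λ : ComplexLattice) : Type := ℂ ⧸ Λ.carrier

/-- The quotient map `ℂ → ℂ / Λ`. -/
abbrev ComplexLattice.proj (Λ : ComplexLattice) (z : ℂ) : Λ.Curve :=
  (QuotientAddGroup.mk z : ℂ ⧸ Λ.carrier)

theorem linearIndependent_one_coe (τ : ℍ) : LinearIndependent ℝ ![(1 : ℂ), (τ : ℂ)] := by
  rw [LinearIndependent.pair_iff]
  intro s t h
  have him := congrArg Complex.im h
  have hre := congrArg Complex.re h
  simp only [Complex.real_smul, mul_one, Complex.add_im, Complex.ofReal_im, Complex.mul_im,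
    Complex.ofReal_re, zero_mul, add_zero, zero_add, Complex.zero_im, mul_eq_zero] at him
  have ht : t = 0 := him.resolve_right τ.im_pos.ne'
  subst ht
  simpa using hre

/-- The normalized lattice `Λ_τ = ℤ ⊕ τ ℤ`. -/
def latticeOf (τ : ℍ) : ComplexLattice where
  carrier := AddSubgroup.closure {1, (τ : ℂ)}
  exists_basis := ⟨1, τ, linearIndependent_one_coe τ, rfl⟩

/-- A map `ℂ / Λ → ℂ / Λ'` is holomorphic if locally it lifts to a holomorphic function on `ℂ`. -/
def IsHolomorphic {Λ Λ' : ComplexLattice} (f : Λ.Curve → Λ'.Curve) : Prop :=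
  ∀ z₀ : ℂ, ∃ g : ℂ → ℂ, AnalyticAt ℂ g z₀ ∧ ∀ᶠ z in 𝓝 z₀, f (Λ.proj z) = Λ'.proj (g z)

theorem IsHolomorphic.id (Λ : ComplexLattice) : IsHolomorphic (fun x : Λ.Curve => x) :=
  fun _ => ⟨fun z => z, analyticAt_id, Filter.Eventually.of_forall fun _ => rfl⟩

theorem IsHolomorphic.comp {Λ Λ' Λ'' : ComplexLattice} {f' : Λ'.Curve → Λ''.Curve}
    {f : Λ.Curve → Λ'.Curve} (hf' : IsHolomorphic f') (hf : IsHolomorphic f) :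
    IsHolomorphic (fun x => f' (f x)) := by
  intro z₀
  obtain ⟨g, hg, hfg⟩ := hf z₀
  obtain ⟨g', hg', hfg'⟩ := hf' (g z₀)
  refine ⟨fun z => g' (g z), hg'.comp hg, ?_⟩
  filter_upwards [hfg, hg.continuousAt.eventually hfg'] with z h1 h2
  rw [h1, h2]

/-- An isomorphism of elliptic curves `ℂ / Λ ≅ ℂ / Λ'`: a biholomorphic group isomorphism. -/
structure CurveIso (Λ Λ' : ComplexLattice) where
  toAddEquiv : Λ.Curve ≃+ Λ'.Curve
  holomorphic : IsHolomorphic toAddEquiv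
  holomorphic_symm : IsHolomorphic toAddEquiv.symm

instance (Λ Λ' : ComplexLattice) : CoeFun (CurveIso Λ Λ') (fun _ => Λ.Curve → Λ'.Curve) :=
  ⟨fun f => f.toAddEquiv⟩

namespace CurveIso

/-- The identity automorphism. -/
def refl (Λ : ComplexLattice) : CurveIso Λ Λ :=
  ⟨AddEquiv.refl _, IsHolomorphic.id Λ, IsHolomorphic.id Λ⟩

/-- The inverse isomorphism. -/
def symm {Λ Λ' : ComplexLattice} (f : CurveIso Λ Λ') : CurveIso Λ' Λ :=
  ⟨f.toAddEquiv.symm, f.holomorphic_symm, f.holomorphic⟩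

/-- The composite `f' ∘ f`. -/
def trans {Λ Λ' Λ'' : ComplexLattice} (f : CurveIso Λ Λ') (f' : CurveIso Λ' Λ'') :
    CurveIso Λ Λ'' :=
  ⟨f.toAddEquiv.trans f'.toAddEquiv, f'.holomorphic.comp f.holomorphic,
    f.holomorphic_symm.comp f'.holomorphic_symm⟩

end CurveIso

theorem smul_I_mem {z : ℂ} (hz : z ∈ (latticeOf UpperHalfPlane.I).carrier) :
    Complex.I * z ∈ (latticeOf UpperHalfPlane.I).carrier := by
  have h1 : (1 : ℂ) ∈ (latticeOf UpperHalfPlane.I).carrier := AddSubgroup.subset_closure (by simp)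
  have hI : Complex.I ∈ (latticeOf UpperHalfPlane.I).carrier := AddSubgroup.subset_closure (by simp)
  induction hz using AddSubgroup.closure_induction with
  | mem x hx =>
    rcases hx with rfl | hx
    · simpa using hI
    · have hx' : x = Complex.I := by simpa using hx
      subst hx'
      simpa using neg_mem h1
  | zero => simp
  | add x y _ _ hx hy => simpa [mul_add] using add_mem hx hy
  | neg x _ hx => simpa using neg_mem hx

/-- The automorphism `z ↦ i z` of the square elliptic curve `ℂ / Λ_i`. -/
def mulI : CurveIso (latticeOf UpperHalfPlane.I) (latticeOf UpperHalfPlane.I) where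
  toAddEquiv :=
    { toFun := QuotientAddGroup.map _ _ (AddMonoidHom.mulLeft Complex.I)
        (fun _ h => AddSubgroup.mem_comap.2 (smul_I_mem h))
      invFun := QuotientAddGroup.map _ _ (AddMonoidHom.mulLeft (-Complex.I))
        (fun _ h => AddSubgroup.mem_comap.2 (by simpa using neg_mem (smul_I_mem h)))
      left_inv := by
        intro x
        induction x using QuotientAddGroup.induction_on with
        | H z => simp [← mul_assoc]
      right_inv := by
        intro x
        induction x using QuotientAddGroup.induction_on with
        | H z => simp [← mul_assoc]
      map_add' := map_add _ }
  holomorphic := fun _ => ⟨fun z => Complex.I * z, by fun_prop,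
    Filter.Eventually.of_forall fun _ => rfl⟩
  holomorphic_symm := fun _ => ⟨fun z => -Complex.I * z, by fun_prop,
    Filter.Eventually.of_forall fun _ => rfl⟩

theorem mulI_proj (z : ℂ) : mulI ((latticeOf UpperHalfPlane.I).proj z) = (latticeOf UpperHalfPlane.I).proj (Complex.I * z) := rfl

/-! ### Continuous families of elliptic curves -/

/-- The disjoint union `⨆ E_u` of the curves `E_u = ℂ / Λ_u`, `u ∈ U`. It carries no topology of
its own; a topology on it is part of the data of a family. -/
structure TotalSpace {U : Type} (L : U → ComplexLattice) where
  base : U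
  point : (L base).Curve

/-- A continuous family of elliptic curves over `U`: curves `E_u = ℂ / Λ_u` and a topology on
`E = ⨆ E_u` for which `E → U` is continuous and which is locally trivial in the following sense.
Each point of `U` has an open neighbourhood `V` with a continuous map `τ : V → ℍ` and isomorphisms
`ℂ / Λ_{τ(v)} ≅ E_v` such that the fibrewise surjective map
`V × ℂ → E`, `(v, z) ↦ [z] ∈ ℂ / Λ_{τ(v)} ≅ E_v` is continuous and open, that is, `E|_V` is
the quotient of `V × ℂ` by the lattices `Λ_{τ(v)}`, with the quotient topology. -/
structure EllipticFamily (U : Type) [TopologicalSpace U] where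
  lattice : U → ComplexLattice
  topology : TopologicalSpace (TotalSpace lattice)
  continuous_base : Continuous (TotalSpace.base : TotalSpace lattice → U)
  locallyTrivial : ∀ u : U, ∃ V : TopologicalSpace.Opens U, u ∈ V ∧
    ∃ (τ : C(V, ℍ)) (φ : ∀ v : V, CurveIso (latticeOf (τ v)) (lattice v)),
      Continuous (fun x : V × ℂ => (⟨x.1, φ x.1 ((latticeOf (τ x.1)).proj x.2)⟩ :
        TotalSpace lattice)) ∧
      IsOpenMap (fun x : V × ℂ => (⟨x.1, φ x.1 ((latticeOf (τ x.1)).proj x.2)⟩ :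
        TotalSpace lattice))

namespace EllipticFamily

variable {U : Type} [TopologicalSpace U]

/-- The total space `E = ⨆ E_u` of a family. -/
abbrev Total (E : EllipticFamily U) : Type := TotalSpace E.lattice

instance (E : EllipticFamily U) : TopologicalSpace E.Total := E.topology

/-- An isomorphism of families over `U`: a homeomorphism `E ≅ E'` over `U` which restricts to an
isomorphism of elliptic curves `E_u ≅ E'_u` on each fibre. -/
structure Iso (E E' : EllipticFamily U) where
  fiber : ∀ u, CurveIso (E.lattice u) (E'.lattice u)
  continuous_toFun : Continuous (fun x : E.Total => (⟨x.base, fiber x.base x.point⟩ : E'.Total))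
  continuous_invFun :
    Continuous (fun x : E'.Total => (⟨x.base, (fiber x.base).symm x.point⟩ : E.Total))

/-- Two families are equivalent if they are isomorphic. -/
instance setoid (U : Type) [TopologicalSpace U] : Setoid (EllipticFamily U) where
  r E E' := Nonempty (Iso E E')
  iseqv :=
    { refl := fun _ => ⟨⟨fun _ => CurveIso.refl _, continuous_id, continuous_id⟩⟩
      symm := fun ⟨f⟩ => ⟨⟨fun u => (f.fiber u).symm, f.continuous_invFun, f.continuous_toFun⟩⟩
      trans := fun ⟨f⟩ ⟨g⟩ => ⟨⟨fun u => (f.fiber u).trans (g.fiber u),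
        g.continuous_toFun.comp f.continuous_toFun,
        f.continuous_invFun.comp g.continuous_invFun⟩⟩ }

variable {U' : Type} [TopologicalSpace U']

/-- The pullback `U' ×_U E` along `f : U' → U`: its fibre over `u'` is `E_{f(u')}`, and its
topology is that of a subspace of `U' × E`. -/
def pullback (f : C(U', U)) (E : EllipticFamily U) : EllipticFamily U' where
  lattice u := E.lattice (f u)
  topology := TopologicalSpace.induced
    (fun x : TotalSpace (fun u => E.lattice (f u)) => (x.base, (⟨f x.base, x.point⟩ : E.Total)))
    inferInstance
  continuous_base := by
    let _ : TopologicalSpace (TotalSpace (fun u => E.lattice (f u))) := TopologicalSpace.induced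
      (fun x => (x.base, (⟨f x.base, x.point⟩ : E.Total))) inferInstance
    exact continuous_fst.comp (continuous_induced_dom (f := fun x :
      TotalSpace (fun u => E.lattice (f u)) => (x.base, (⟨f x.base, x.point⟩ : E.Total))))
  locallyTrivial := by
    let _ : TopologicalSpace (TotalSpace (fun u => E.lattice (f u))) := TopologicalSpace.induced
      (fun x => (x.base, (⟨f x.base, x.point⟩ : E.Total))) inferInstance
    intro u
    obtain ⟨V, hu, τ, φ, hcont, hopen⟩ := E.locallyTrivial (f u)
    let fV : C((V.comap f : TopologicalSpace.Opens U'), V) :=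
      ⟨fun v => ⟨f v, v.2⟩, by fun_prop⟩
    refine ⟨V.comap f, hu, τ.comp fV, fun v => φ (fV v), ?_, ?_⟩
    · refine continuous_induced_rng.2 ?_
      exact (continuous_subtype_val.comp continuous_fst).prodMk
        (hcont.comp ((fV.continuous.comp continuous_fst).prodMk continuous_snd))
    · intro W hW
      rw [isOpen_iff_forall_mem_open]
      rintro _ ⟨⟨v, z⟩, hvz, rfl⟩
      obtain ⟨A, B, hA, hB, hvA, hzB, hAB⟩ := isOpen_prod_iff.1 hW v z hvz
      have hA' := (V.comap f).isOpen.isOpenMap_subtype_val A hA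
      have hB' := hopen _ ((isOpen_univ (X := V)).prod hB)
      refine ⟨_, ?_, isOpen_induced (hA'.prod hB'), ?_⟩
      · rintro ⟨w, x⟩ ⟨⟨w', hw', hww'⟩, ⟨⟨v', z'⟩, ⟨-, hz'⟩, hx⟩⟩
        obtain rfl : (w' : U') = w := hww'
        refine ⟨(w', z'), hAB ⟨hw', hz'⟩, ?_⟩
        have hv : v' = fV w' := Subtype.ext (congrArg TotalSpace.base hx)
        subst hv
        have hx' := eq_of_heq (TotalSpace.mk.inj hx).2
        exact congrArg (fun y => (⟨(w' : U'), y⟩ : TotalSpace (fun u => E.lattice (f u)))) hx'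
      · exact ⟨⟨v, hvA, rfl⟩, ⟨(fV v, z), ⟨trivial, hzB⟩, rfl⟩⟩

theorem continuous_pullback_iff {f : C(U', U)} {E : EllipticFamily U} {X : Type*}
    [TopologicalSpace X] {g : X → (E.pullback f).Total} :
    Continuous g ↔ Continuous (fun x => (g x).base) ∧
      Continuous (fun x => (⟨f (g x).base, (g x).point⟩ : E.Total)) := by
  refine continuous_induced_rng.trans ?_
  exact continuous_prodMk

theorem continuous_pullback_snd (f : C(U', U)) (E : EllipticFamily U) :
    Continuous (fun x : (E.pullback f).Total => (⟨f x.base, x.point⟩ : E.Total)) :=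
  (continuous_pullback_iff.1 continuous_id).2

theorem pullback_congr (f : C(U', U)) {E E' : EllipticFamily U} (h : E ≈ E') :
    E.pullback f ≈ E'.pullback f := by
  obtain ⟨g⟩ := h
  refine ⟨⟨fun u => g.fiber (f u), ?_, ?_⟩⟩
  · exact continuous_pullback_iff.2 ⟨continuous_base _,
      g.continuous_toFun.comp (continuous_pullback_snd f E)⟩
  · exact continuous_pullback_iff.2 ⟨continuous_base _,
      g.continuous_invFun.comp (continuous_pullback_snd f E')⟩

theorem pullback_id (E : EllipticFamily U) : E.pullback (ContinuousMap.id U) ≈ E :=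
  ⟨⟨fun _ => CurveIso.refl _, continuous_pullback_snd (ContinuousMap.id U) E,
    continuous_pullback_iff.2 ⟨E.continuous_base, continuous_id⟩⟩⟩

theorem pullback_comp {U'' : Type} [TopologicalSpace U''] (f : C(U', U)) (g : C(U'', U'))
    (E : EllipticFamily U) : E.pullback (f.comp g) ≈ (E.pullback f).pullback g :=
  ⟨⟨fun _ => CurveIso.refl _,
    continuous_pullback_iff.2 ⟨continuous_base _, continuous_pullback_iff.2
      ⟨g.continuous.comp (continuous_base _), continuous_pullback_snd (f.comp g) E⟩⟩,
    continuous_pullback_iff.2 ⟨continuous_base _,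
      (continuous_pullback_snd f E).comp (continuous_pullback_snd g (E.pullback f))⟩⟩⟩

end EllipticFamily

/-! ### The moduli functor and the coarse space -/

/-- The moduli functor of elliptic curves: `U` goes to the set of isomorphism classes of continuous
families of elliptic curves over `U`, and a continuous map `U' → U` to the pullback of families. -/
def moduliFunctor : TopCat.{0}ᵒᵖ ⥤ Type where
  obj U := Quotient (EllipticFamily.setoid U.unop)
  map f := TypeCat.ofHom
    (Quotient.map (EllipticFamily.pullback f.unop.hom) fun _ _ h =>
      EllipticFamily.pullback_congr _ h)
  map_id U := by
    ext x
    induction x using Quotient.inductionOn with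
    | h E => exact Quotient.sound (EllipticFamily.pullback_id E)
  map_comp f g := by
    ext x
    induction x using Quotient.inductionOn with
    | h E => exact Quotient.sound (EllipticFamily.pullback_comp f.unop.hom g.unop.hom E)

/-- The isomorphism class of a family. -/
def EllipticFamily.cls {U : Type} [TopologicalSpace U] (E : EllipticFamily U) :
    moduliFunctor.obj (Opposite.op (TopCat.of U)) :=
  Quotient.mk (EllipticFamily.setoid U) E

/-- The space `ℍ / PSL₂(ℤ)` with the quotient topology. As `-1` acts trivially on `ℍ`, it is the
space of orbits of `SL₂(ℤ)`. -/
abbrev ModuliSpace : Type := MulAction.orbitRel.Quotient SL(2, ℤ) ℍ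

/-- The point `[τ]` of `ℍ / PSL₂(ℤ)`. -/
def modulus (τ : ℍ) : ModuliSpace := Quotient.mk _ τ

/-- `c : U → ℍ / PSL₂(ℤ)` is the classifying map of the family `E` if it sends each `u` to the
isomorphism class of `E_u`, that is, to `[τ]` for a `τ` with `E_u ≅ ℂ / Λ_τ`. -/
def IsClassifyingMap {U : Type} [TopologicalSpace U] (E : EllipticFamily U)
    (c : C(U, ModuliSpace)) : Prop :=
  ∀ u, ∃ τ : ℍ, c u = modulus τ ∧ Nonempty (CurveIso (E.lattice u) (latticeOf τ))

/-! ### Gluing the constant family over `[0, 1]` -/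

/-- The circle `ℝ / ℤ`, that is, `[0, 1]` with its end points identified. -/
abbrev S1 : Type := UnitAddCircle

/-- The family `E` over the circle is obtained from the constant family `[0, 1] × ℂ / Λ` by gluing
the fibre over `1` to the fibre over `0` along the automorphism `f` of `ℂ / Λ`: there is a
quotient map `q : [0, 1] × ℂ / Λ → E` over `[0, 1] → ℝ / ℤ` which is an isomorphism of elliptic
curves on each fibre, with `q (1, x) = q (0, f x)`. -/
def IsGluedAlong {Λ : ComplexLattice} (f : CurveIso Λ Λ) (E : EllipticFamily S1) : Prop :=
  ∃ q : ∀ t : unitInterval, CurveIso Λ (E.lattice ((t : ℝ) : S1)),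
    IsQuotientMap (fun p : unitInterval × Λ.Curve =>
      (⟨((p.1 : ℝ) : S1), q p.1 p.2⟩ : E.Total)) ∧
    ∀ x : Λ.Curve,
      (⟨(((1 : unitInterval) : ℝ) : S1), q 1 x⟩ : E.Total) =
        ⟨(((0 : unitInterval) : ℝ) : S1), q 0 (f x)⟩

end EllModuli

end

/-! A continuous map is determined by its values at points. By naturality, a transformation from
families to `Mor(-, M)` therefore sees only the restrictions of a family to points, and a family
over a point is determined by its fibre (`app_cls_eq_const`). Two non-isomorphic families with the
same constant fibre then have the same image, so no such transformation is injective and `M` cannot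
represent the functor.

The two families are the mapping tori of `1` and of `mulI`. They differ by monodromy on 2-torsion:
the 2-torsion points form a finite discrete set, so an isomorphism would carry a constant 2-torsion
section of the trivial family to a monodromy-invariant one, whereas multiplication by `i` moves the
class of `1/2` (`torusFamily_not_iso`).

For the classifying map, an isomorphism onto `ℂ / Λ_i` lifts to multiplication by some `α`
(`exists_mul_of_curveIso`). Comparing lattice bases gives an integral matrix of determinant one
taking `i` to `τ` (`modulus_eq_of_curveIso`). -/

namespace EllModuli

variable {Λ Λ' : ComplexLattice}

/-! ### Automorphism groups of elliptic curves -/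

namespace CurveIso

theorem continuous (f : CurveIso Λ Λ') : Continuous f := by
  refine QuotientAddGroup.isOpenQuotientMap_mk.isQuotientMap.continuous_iff.2
    (continuous_iff_continuousAt.2 fun z₀ => ?_)
  obtain ⟨g, hg, hfg⟩ := f.holomorphic z₀
  have h : ContinuousAt (fun z => Λ'.proj (g z)) z₀ :=
    ContinuousAt.comp (g := Λ'.proj) QuotientAddGroup.continuous_mk.continuousAt hg.continuousAt
  exact h.congr (hfg.mono fun _ h => h.symm)

theorem toAddEquiv_injective :
    Function.Injective (toAddEquiv : CurveIso Λ Λ' → Λ.Curve ≃+ Λ'.Curve) := by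
  rintro ⟨f, _, _⟩ ⟨g, _, _⟩ rfl
  rfl

/-- The automorphisms of an elliptic curve form a group under composition. -/
instance : Group (CurveIso Λ Λ) where
  mul f g := g.trans f
  one := refl Λ
  inv f := f.symm
  mul_assoc _ _ _ := rfl
  one_mul _ := rfl
  mul_one _ := rfl
  inv_mul_cancel f := toAddEquiv_injective (AddEquiv.self_trans_symm f.toAddEquiv)

theorem mul_apply (f g : CurveIso Λ Λ) (x : Λ.Curve) : (f * g) x = f (g x) := rfl

@[simp] theorem one_apply (x : Λ.Curve) : (1 : CurveIso Λ Λ) x = x := rfl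

@[simp] theorem apply_symm_apply (f : CurveIso Λ Λ') (x : Λ'.Curve) : f (f.symm x) = x :=
  f.toAddEquiv.apply_symm_apply x

end CurveIso

/-! ### The mapping torus of an automorphism -/

/-- The map `ℝ × ℂ / Λ → ⨆ ℂ / Λ` exhibiting the mapping torus of `f` as the quotient by
`(t + 1, x) ∼ (t, f x)`. -/
noncomputable def torusMap (f : CurveIso Λ Λ) (p : ℝ × Λ.Curve) : TotalSpace (fun _ : S1 => Λ) :=
  ⟨((p.1 : ℝ) : S1), (f ^ ⌊p.1⌋ : CurveIso Λ Λ) p.2⟩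

variable (f : CurveIso Λ Λ)

theorem torusMap_add_int (t : ℝ) (n : ℤ) (x : Λ.Curve) :
    torusMap f (t + n, x) = torusMap f (t, (f ^ n : CurveIso Λ Λ) x) := by
  have h : ((t + n : ℝ) : S1) = (t : S1) := by
    refine QuotientAddGroup.eq.2 (AddSubgroup.mem_zmultiples_iff.2 ⟨-n, ?_⟩)
    simp
  simp only [torusMap, Int.floor_add_intCast, zpow_add, CurveIso.mul_apply]
  exact congrArg (fun s => (⟨s, _⟩ : TotalSpace (fun _ : S1 => Λ))) h

theorem exists_int_of_coe_eq {t t' : ℝ} (h : (t : S1) = t') : ∃ n : ℤ, t = t' + n := by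
  obtain ⟨n, hn⟩ := AddSubgroup.mem_zmultiples_iff.1 (QuotientAddGroup.eq.1 h.symm)
  rw [zsmul_one] at hn
  exact ⟨n, by linarith⟩

theorem exists_int_of_torusMap_eq {t t' : ℝ} {x x' : Λ.Curve}
    (h : torusMap f (t, x) = torusMap f (t', x')) :
    ∃ n : ℤ, t = t' + n ∧ x' = (f ^ n : CurveIso Λ Λ) x := by
  obtain ⟨n, rfl⟩ := exists_int_of_coe_eq (congrArg TotalSpace.base h)
  refine ⟨n, rfl, ?_⟩
  rw [torusMap_add_int] at h
  exact ((f ^ ⌊t'⌋ : CurveIso Λ Λ).toAddEquiv.injective (eq_of_heq (TotalSpace.mk.inj h).2)).symm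

theorem torusMap_injOn {t t' : ℝ} {x x' : Λ.Curve} (ht : |t - t'| < 1)
    (h : torusMap f (t, x) = torusMap f (t', x')) : t = t' ∧ x = x' := by
  obtain ⟨n, rfl, rfl⟩ := exists_int_of_torusMap_eq f h
  obtain rfl : n = 0 := by
    rw [add_sub_cancel_left] at ht
    exact Int.abs_lt_one_iff.1 (by exact_mod_cast ht)
  simp

/-- The quotient topology on the mapping torus. -/
noncomputable abbrev torusTopology : TopologicalSpace (TotalSpace (fun _ : S1 => Λ)) :=
  TopologicalSpace.coinduced (torusMap f) inferInstance

theorem torusMap_surjective : Function.Surjective (torusMap f) := by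
  rintro ⟨s, x⟩
  obtain ⟨t, rfl⟩ := QuotientAddGroup.mk_surjective s
  exact ⟨(t, (f ^ ⌊t⌋ : CurveIso Λ Λ).symm x),
    congrArg (fun y => (⟨(t : S1), y⟩ : TotalSpace (fun _ : S1 => Λ)))
      ((f ^ ⌊t⌋ : CurveIso Λ Λ).apply_symm_apply x)⟩

/-- The saturation of an open set is the union of its translates under the action of `ℤ` on `ℝ × ℂ /
Λ` by homeomorphisms. -/
theorem isOpenMap_torusMap : @IsOpenMap _ _ _ (torusTopology f) (torusMap f) := by
  intro W hW
  refine isOpen_coinduced.2 ?_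
  have h : torusMap f ⁻¹' (torusMap f '' W) =
      ⋃ n : ℤ, (fun p : ℝ × Λ.Curve => (p.1 + n, (f ^ (-n) : CurveIso Λ Λ) p.2)) ⁻¹' W := by
    ext ⟨t, x⟩
    simp only [Set.mem_preimage, Set.mem_iUnion]
    constructor
    · rintro ⟨⟨t', x'⟩, hW, h⟩
      obtain ⟨n, rfl, rfl⟩ := exists_int_of_torusMap_eq f h
      refine ⟨n, ?_⟩
      rwa [← CurveIso.mul_apply, ← zpow_add, neg_add_cancel, zpow_zero, CurveIso.one_apply]
    · rintro ⟨n, h⟩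
      refine ⟨_, h, ?_⟩
      rw [torusMap_add_int, ← CurveIso.mul_apply, ← zpow_add, add_neg_cancel, zpow_zero,
        CurveIso.one_apply]
  rw [h]
  refine isOpen_iUnion fun n => hW.preimage ?_
  exact (continuous_fst.add continuous_const).prodMk ((CurveIso.continuous _).comp continuous_snd)

theorem isOpenQuotientMap_torusMap :
    @IsOpenQuotientMap _ _ _ (torusTopology f) (torusMap f) :=
  @IsOpenQuotientMap.mk _ _ _ (torusTopology f) _ (torusMap_surjective f) continuous_coinduced_rng
    (isOpenMap_torusMap f)

/-- The mapping torus of an automorphism of `ℂ / Λ_τ`, as a family over the circle. -/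
noncomputable def torusFamily {τ : ℍ} (f : CurveIso (latticeOf τ) (latticeOf τ)) :
    EllipticFamily S1 where
  lattice _ := latticeOf τ
  topology := torusTopology f
  continuous_base := continuous_coinduced_dom.2
    ((AddCircle.continuous_mk' 1).comp continuous_fst)
  locallyTrivial u := by
    let _ : TopologicalSpace (TotalSpace (fun _ : S1 => latticeOf τ)) := torusTopology f
    obtain ⟨t, rfl⟩ := QuotientAddGroup.mk_surjective u
    -- The window of length one is centred at `t`, so that `t` is interior. The floor of `ℓ` may
    -- jump inside it; this is harmless, since the trivialization twisted by `f ^ ⌊ℓ v⌋` is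
    -- `torusMap f` composed with `ℓ` and the projection, which is continuous and open.
    let e := AddCircle.openPartialHomeomorphCoe (1 : ℝ) (t - 1 / 2)
    let ℓ : e.target → ℝ := fun v => e.symm v
    have hℓ : IsOpenEmbedding ℓ := e.symm.isOpenEmbedding_restrict
    have hmap : (fun x : e.target × ℂ => (⟨x.1, (f ^ ⌊ℓ x.1⌋ : CurveIso _ _)
        ((latticeOf τ).proj x.2)⟩ : TotalSpace (fun _ : S1 => latticeOf τ))) =
        torusMap f ∘ Prod.map ℓ (latticeOf τ).proj := by
      ext1 x
      exact congrArg (fun s => (⟨s, (f ^ ⌊ℓ x.1⌋ : CurveIso _ _)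
        ((latticeOf τ).proj x.2)⟩ : TotalSpace (fun _ : S1 => latticeOf τ)))
        (e.right_inv x.1.2).symm
    refine ⟨⟨e.target, e.open_target⟩, ?_, ContinuousMap.const _ τ,
      fun v => (f ^ ⌊ℓ v⌋ : CurveIso _ _), ?_, ?_⟩
    · exact e.map_source (x := t) ⟨by linarith, by linarith⟩
    · have h := (isOpenQuotientMap_torusMap f).continuous.comp
        (hℓ.continuous.prodMap (QuotientAddGroup.continuous_mk (N := (latticeOf τ).carrier)))
      exact hmap ▸ h
    · have h := (isOpenMap_torusMap f).comp
        (hℓ.isOpenMap.prodMap (QuotientAddGroup.isOpenMap_coe (N := (latticeOf τ).carrier)))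
      exact hmap ▸ h

theorem locallyFinite_Icc_int : LocallyFinite fun n : ℤ => Set.Icc (n : ℝ) (n + 1) := by
  intro t
  refine ⟨Set.Ioo (t - 1) (t + 1), Ioo_mem_nhds (by linarith) (by linarith),
    (Set.finite_Icc (⌊t⌋ - 2) (⌊t⌋ + 2)).subset ?_⟩
  rintro n ⟨x, ⟨h1, h2⟩, h3, h4⟩
  have h5 := Int.floor_le t
  have h6 := Int.lt_floor_add_one t
  constructor <;> rify <;> linarith

/-- The restriction of `torusMap f` to `[0, 1]` need not be open, so the quotient property is tested
on closed sets. The preimage in `ℝ × ℂ / Λ` is a union of closed translates lying over the intervals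
`[n, n + 1]`, and local finiteness makes the union closed. -/
theorem torusFamily_isGluedAlong {τ : ℍ} (f : CurveIso (latticeOf τ) (latticeOf τ)) :
    IsGluedAlong f (torusFamily f) := by
  let _ : TopologicalSpace (TotalSpace (fun _ : S1 => latticeOf τ)) := torusTopology f
  refine ⟨fun t => (f ^ ⌊(t : ℝ)⌋ : CurveIso _ _), ?_, fun x => ?_⟩
  · let ι : unitInterval × (latticeOf τ).Curve → ℝ × (latticeOf τ).Curve :=
      Prod.map Subtype.val id
    have hι : IsClosedEmbedding ι :=
      (isClosed_Icc.isClosedEmbedding_subtypeVal).prodMap IsClosedEmbedding.id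
    change IsQuotientMap (torusMap f ∘ ι)
    have hcont : Continuous (torusMap f ∘ ι) :=
      (isOpenQuotientMap_torusMap f).continuous.comp hι.continuous
    have hred (t : ℝ) (n : ℤ) (x : (latticeOf τ).Curve) :
        torusMap f (t - n, (f ^ n : CurveIso _ _) x) = torusMap f (t, x) := by
      rw [← torusMap_add_int, sub_add_cancel]
    refine isQuotientMap_iff_isClosed.2 ⟨fun y => ?_, fun S =>
      ⟨fun hS => hS.preimage hcont, fun hS => ?_⟩⟩
    · obtain ⟨⟨t, x⟩, rfl⟩ := torusMap_surjective f y
      exact ⟨(⟨t - ⌊t⌋, Int.fract_nonneg t, (Int.fract_lt_one t).le⟩, _), hred t ⌊t⌋ x⟩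
    · rw [← (isOpenQuotientMap_torusMap f).isQuotientMap.isClosed_preimage]
      have h : torusMap f ⁻¹' S = ⋃ n : ℤ, (fun p : ℝ × (latticeOf τ).Curve =>
          (p.1 - n, (f ^ n : CurveIso _ _) p.2)) ⁻¹' (ι '' ((torusMap f ∘ ι) ⁻¹' S)) := by
        ext ⟨t, x⟩
        simp only [Set.mem_iUnion, Set.mem_preimage]
        constructor
        · intro h
          refine ⟨⌊t⌋, (⟨t - ⌊t⌋, Int.fract_nonneg t, (Int.fract_lt_one t).le⟩, _), ?_, rfl⟩
          exact (congrArg (· ∈ S) (hred t ⌊t⌋ x)).mpr h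
        · rintro ⟨n, q, hq, hqt⟩
          rw [← hred t n x, ← hqt]
          exact hq
      rw [h]
      refine LocallyFinite.isClosed_iUnion ?_ fun n =>
        (hι.isClosedMap _ hS).preimage ((continuous_fst.sub continuous_const).prodMk
          ((CurveIso.continuous _).comp continuous_snd))
      refine (locallyFinite_Icc_int.preimage_continuous
        (continuous_fst (Y := (latticeOf τ).Curve))).subset ?_
      rintro n ⟨t, x⟩ ⟨⟨⟨r, hr0, hr1⟩, y⟩, -, hr⟩
      have hr' : r = t - n := congrArg Prod.fst hr
      constructor <;> simp only <;> linarith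
  · change torusMap f (1, x) = torusMap f (0, f x)
    simpa using torusMap_add_int f 0 1 x

/-! ### The square lattice -/

theorem mem_latticeOf {τ : ℍ} {z : ℂ} :
    z ∈ (latticeOf τ).carrier ↔ ∃ m n : ℤ, (m : ℂ) + n * (τ : ℂ) = z := by
  change z ∈ AddSubgroup.closure {1, (τ : ℂ)} ↔ _
  simp [AddSubgroup.mem_closure_pair]

theorem mem_latticeOf_I {z : ℂ} :
    z ∈ (latticeOf UpperHalfPlane.I).carrier ↔
      (∃ m : ℤ, (m : ℝ) = z.re) ∧ ∃ n : ℤ, (n : ℝ) = z.im := by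
  rw [mem_latticeOf]
  constructor
  · rintro ⟨m, n, rfl⟩
    exact ⟨⟨m, by simp⟩, n, by simp⟩
  · rintro ⟨⟨m, hm⟩, n, hn⟩
    exact ⟨m, n, Complex.ext (by simp [hm]) (by simp [hn])⟩

/-- Closedness makes points of the quotient closed, so that its finite subsets are discrete. -/
instance isClosed_latticeOf_I : IsClosed ((latticeOf UpperHalfPlane.I).carrier : Set ℂ) := by
  have h : ((latticeOf UpperHalfPlane.I).carrier : Set ℂ) =
      Complex.re ⁻¹' Set.range ((↑) : ℤ → ℝ) ∩ Complex.im ⁻¹' Set.range ((↑) : ℤ → ℝ) := by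
    ext z
    exact mem_latticeOf_I
  rw [h]
  have hZ := Int.isClosedEmbedding_coe_real.isClosed_range
  exact (hZ.preimage Complex.continuous_re).inter (hZ.preimage Complex.continuous_im)

theorem eq_zero_of_mem_latticeOf_I {z : ℂ} (hz : z ∈ (latticeOf UpperHalfPlane.I).carrier)
    (h : ‖z‖ < 1) : z = 0 := by
  obtain ⟨⟨m, hm⟩, n, hn⟩ := mem_latticeOf_I.1 hz
  have h1 := (Complex.abs_re_le_norm z).trans_lt h
  have h2 := (Complex.abs_im_le_norm z).trans_lt h
  rw [← hm] at h1
  rw [← hn] at h2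
  have hm0 : m = 0 := Int.abs_lt_one_iff.1 (by exact_mod_cast h1)
  have hn0 : n = 0 := Int.abs_lt_one_iff.1 (by exact_mod_cast h2)
  exact Complex.ext (by simp [← hm, hm0]) (by simp [← hn, hn0])

theorem finite_two_torsion :
    {x : (latticeOf UpperHalfPlane.I).Curve | x + x = 0}.Finite := by
  refine ((Set.finite_Icc (0 : ℤ) 1).image2 (fun a b : ℤ =>
    (latticeOf UpperHalfPlane.I).proj ((a : ℂ) / 2 + b / 2 * Complex.I))
    (Set.finite_Icc (0 : ℤ) 1)).subset ?_
  intro x hx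
  obtain ⟨z, rfl⟩ := QuotientAddGroup.mk_surjective x
  obtain ⟨m, n, hz⟩ := mem_latticeOf.1 ((QuotientAddGroup.eq_zero_iff (z + z)).1 hx)
  refine ⟨m % 2, ?_, n % 2, ?_, ?_⟩
  · constructor <;> omega
  · constructor <;> omega
  · refine QuotientAddGroup.eq.2 (mem_latticeOf.2 ⟨m / 2, n / 2, ?_⟩)
    have hm : (m : ℂ) = 2 * (m / 2 : ℤ) + (m % 2 : ℤ) := by
      exact_mod_cast (Int.mul_ediv_add_emod m 2).symm
    have hn : (n : ℂ) = 2 * (n / 2 : ℤ) + (n % 2 : ℤ) := by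
      exact_mod_cast (Int.mul_ediv_add_emod n 2).symm
    rw [hm, hn, UpperHalfPlane.coe_I] at hz
    rw [UpperHalfPlane.coe_I]
    linear_combination hz / 2

theorem mulI_half_ne : mulI ((latticeOf UpperHalfPlane.I).proj (1 / 2)) ≠
    (latticeOf UpperHalfPlane.I).proj (1 / 2) := by
  intro h
  obtain ⟨⟨m, hm⟩, -⟩ := mem_latticeOf_I.1 (QuotientAddGroup.eq.1 h)
  have h1 : (m : ℝ) = 1 / 2 := by simpa using hm
  have h2 : (2 * m : ℤ) = 1 := by
    have : (2 * m : ℝ) = 1 := by linarith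
    exact_mod_cast this
  omega

/-! ### The two families are not isomorphic -/

/-- Over a window of length one, `torusMap f` is open and injective, so continuity can be lifted
through it. -/
theorem continuous_of_torusMap_comp {Λ : ComplexLattice} (f : CurveIso Λ Λ)
    (h : ℝ → Λ.Curve)
    (hh : @Continuous _ _ _ (torusTopology f) fun t => torusMap f (t, h t)) : Continuous h := by
  let _ : TopologicalSpace (TotalSpace (fun _ : S1 => Λ)) := torusTopology f
  refine continuous_iff_continuousAt.2 fun t₀ W hW => ?_
  obtain ⟨W', hW'W, hW', hmem⟩ := mem_nhds_iff.1 hW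
  have ho := isOpenMap_torusMap f _
    ((isOpen_Ioo (a := t₀ - 1 / 2) (b := t₀ + 1 / 2)).prod hW')
  have h1 := hh.continuousAt.preimage_mem_nhds (x := t₀) (ho.mem_nhds
    ⟨(t₀, h t₀), ⟨⟨by linarith, by linarith⟩, hmem⟩, rfl⟩)
  change ∀ᶠ t in 𝓝 t₀, h t ∈ W
  filter_upwards [h1, Ioo_mem_nhds (sub_lt_self t₀ one_half_pos)
    (lt_add_of_pos_right t₀ one_half_pos)] with t ht ht'
  obtain ⟨⟨t', w⟩, ⟨hm1, hm2⟩, heq⟩ := ht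
  have hlt : |t' - t| < 1 :=
    abs_sub_lt_iff.2 ⟨by linarith [hm1.2, ht'.1], by linarith [hm1.1, ht'.2]⟩
  exact hW'W ((torusMap_injOn f hlt heq).2 ▸ hm2)

theorem torusFamily_not_iso :
    IsEmpty (EllipticFamily.Iso (torusFamily (1 : CurveIso (latticeOf UpperHalfPlane.I) _))
      (torusFamily mulI)) := by
  refine ⟨fun g => ?_⟩
  let Λ := latticeOf UpperHalfPlane.I
  let y : Λ.Curve := Λ.proj (1 / 2)
  have hy : y + y = 0 := by
    refine (QuotientAddGroup.eq_zero_iff _).2 (mem_latticeOf_I.2 ⟨⟨1, ?_⟩, 0, ?_⟩) <;> norm_num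
  let G : S1 → CurveIso Λ Λ := g.fiber
  let x : Λ.Curve := (G 0).symm y
  -- The inverse power cancels the twist in `torusMap mulI`, so `h` is the lift to `ℝ × ℂ / Λ` of
  -- the image of the constant section `x`. Its values at `0` and `1` differ by the monodromy.
  let h : ℝ → Λ.Curve := fun t => (mulI ^ ⌊t⌋ : CurveIso Λ Λ).symm (G t x)
  have hcont : Continuous h := by
    refine continuous_of_torusMap_comp mulI h ?_
    have h1 := @Continuous.comp _ _ _ _ _ (torusTopology 1) _ _
      (continuous_coinduced_rng (f := torusMap (1 : CurveIso Λ Λ)))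
      (continuous_id.prodMk continuous_const : Continuous fun t : ℝ => (t, x))
    have h2 := @Continuous.comp _ _ _ _ (torusTopology 1) (torusTopology mulI) _ _
      g.continuous_toFun h1
    convert h2 using 2 with t
    simp only [torusMap, Function.comp, one_zpow, h, CurveIso.apply_symm_apply]
    rfl
  have htor (t : ℝ) : h t + h t = 0 := by
    have hx : x + x = 0 := by
      change (G 0).toAddEquiv.symm y + (G 0).toAddEquiv.symm y = 0
      rw [← map_add, hy, map_zero]
    change (mulI ^ ⌊t⌋ : CurveIso Λ Λ).toAddEquiv.symm ((G t).toAddEquiv x) +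
      (mulI ^ ⌊t⌋ : CurveIso Λ Λ).toAddEquiv.symm ((G t).toAddEquiv x) = 0
    rw [← map_add, ← map_add, hx, map_zero, map_zero]
  -- A continuous map from the connected line to a discrete set is constant.
  have := finite_two_torsion.to_subtype
  have h01 : h 0 = h 1 := isPreconnected_univ.constant_of_mapsTo
    (T := {x : Λ.Curve | x + x = 0}) ⟨inferInstance⟩ hcont.continuousOn
    (fun t _ => htor t) trivial trivial
  have hG : G ((1 : ℝ) : S1) = G 0 := congrArg G (AddCircle.coe_period 1)
  have h0 : h 0 = y := by
    simp only [h, Int.floor_zero, zpow_zero]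
    exact (G 0).apply_symm_apply y
  have h1 : h 1 = mulI.symm y := by
    simp only [h, Int.floor_one, zpow_one, hG]
    exact congrArg mulI.symm ((G 0).apply_symm_apply y)
  rw [h0, h1] at h01
  exact mulI_half_ne ((congrArg mulI h01).trans (mulI.apply_symm_apply y))

/-! ### Isomorphisms lift to multiplications -/

/-- A local lift `g` at `0`, normalized by `g 0 = 0`, satisfies `g z = 2 * g (z / 2)` near `0` by
discreteness of the lattice. Differentiability at `0` then forces linearity, and additivity of `f`
extends the formula from a small ball to all of `ℂ`. -/
theorem exists_mul_of_curveIso {Λ : ComplexLattice}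
    (f : CurveIso Λ (latticeOf UpperHalfPlane.I)) :
    ∃ α : ℂ, ∀ z, f (Λ.proj z) = (latticeOf UpperHalfPlane.I).proj (α * z) := by
  obtain ⟨g₀, hg₀, hfg₀⟩ := f.holomorphic 0
  have h0mem : g₀ 0 ∈ (latticeOf UpperHalfPlane.I).carrier := by
    refine (QuotientAddGroup.eq_zero_iff _).1 (hfg₀.self_of_nhds.symm.trans ?_)
    exact map_zero f.toAddEquiv
  let g : ℂ → ℂ := fun z => g₀ z - g₀ 0
  have hg : AnalyticAt ℂ g 0 := hg₀.sub analyticAt_const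
  have hg0 : g 0 = 0 := sub_self _
  have hfg : ∀ᶠ z in 𝓝 0, f (Λ.proj z) = (latticeOf UpperHalfPlane.I).proj (g z) := by
    filter_upwards [hfg₀] with z hz
    rw [hz]
    refine QuotientAddGroup.eq.2 ?_
    have e : -g₀ z + g z = -g₀ 0 := by
      simp only [g]
      ring
    exact e ▸ neg_mem h0mem
  -- With this bound `g z - 2 * g (z / 2)` has norm below `3 / 4`, while nonzero vectors of `Λ_i`
  -- have norm at least one.
  have hsmall : ∀ᶠ z in 𝓝 0, ‖g z‖ < 1 / 4 := by
    refine hg.continuousAt.norm.eventually_lt_const ?_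
    simp [hg0]
  obtain ⟨ε, hε, hball⟩ := Metric.eventually_nhds_iff_ball.1 (hfg.and hsmall)
  have hhalf (z : ℂ) (hz : z ∈ Metric.ball 0 ε) : g z = 2 * g (z / 2) := by
    have hz2 : z / 2 ∈ Metric.ball 0 ε := by
      rw [mem_ball_zero_iff] at hz ⊢
      rw [norm_div, Complex.norm_ofNat]
      linarith [norm_nonneg z]
    obtain ⟨h1, h2⟩ := hball z hz
    obtain ⟨h3, h4⟩ := hball _ hz2
    have h5 : (latticeOf UpperHalfPlane.I).proj (2 * g (z / 2)) =
        (latticeOf UpperHalfPlane.I).proj (g z) := by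
      rw [← h1, two_mul]
      change (latticeOf UpperHalfPlane.I).proj (g (z / 2)) +
        (latticeOf UpperHalfPlane.I).proj (g (z / 2)) = _
      rw [← h3, ← map_add]
      exact congrArg (fun w => f (Λ.proj w)) (add_halves z)
    have h6 := eq_zero_of_mem_latticeOf_I (QuotientAddGroup.eq.1 h5) <| by
      calc ‖-(2 * g (z / 2)) + g z‖ ≤ ‖-(2 * g (z / 2))‖ + ‖g z‖ := norm_add_le _ _
        _ = 2 * ‖g (z / 2)‖ + ‖g z‖ := by rw [norm_neg, norm_mul, Complex.norm_ofNat]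
        _ < 1 := by linarith
    linear_combination h6
  have hpow (n : ℕ) : ∀ z ∈ Metric.ball (0 : ℂ) ε, g z = 2 ^ n * g (z / 2 ^ n) := by
    induction n with
    | zero => simp
    | succ n ih =>
      intro z hz
      have hz2 : z / 2 ^ n ∈ Metric.ball 0 ε := by
        rw [mem_ball_zero_iff] at hz ⊢
        rw [norm_div, norm_pow, Complex.norm_ofNat]
        exact (div_le_self (norm_nonneg z) (one_le_pow₀ one_le_two)).trans_lt hz
      rw [ih z hz, hhalf _ hz2, div_div, ← pow_succ, ← mul_assoc, ← pow_succ]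
  have hlin (z : ℂ) (hz : z ∈ Metric.ball 0 ε) : g z = deriv g 0 * z := by
    have hd : HasDerivAt (fun w : ℂ => g (w * z)) (deriv g 0 * z) 0 := by
      have h1 : HasDerivAt g (deriv g 0) (0 * z) := by
        rw [zero_mul]
        exact hg.differentiableAt.hasDerivAt
      simpa [Function.comp_def] using h1.comp (0 : ℂ) ((hasDerivAt_id (0 : ℂ)).mul_const z)
    have hseq : Filter.Tendsto (fun n : ℕ => ((2 : ℂ) ^ n)⁻¹) Filter.atTop (𝓝[≠] 0) := by
      refine tendsto_nhdsWithin_iff.2 ⟨?_, Filter.Eventually.of_forall fun n => by simp⟩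
      simp_rw [← inv_pow]
      exact tendsto_pow_atTop_nhds_zero_of_norm_lt_one (by norm_num)
    -- Along `2⁻ⁿ` the difference quotients are `2 ^ n * g (z / 2 ^ n)`, all equal to `g z`.
    have hlim := hd.tendsto_slope_zero.comp hseq
    refine tendsto_nhds_unique (tendsto_const_nhds.congr fun n => ?_) hlim
    simp only [Function.comp, zero_add, zero_mul, hg0, sub_zero, inv_inv, smul_eq_mul]
    rw [hpow n z hz, div_eq_inv_mul]
  refine ⟨deriv g 0, fun z => ?_⟩
  obtain ⟨n, hn⟩ := exists_nat_gt (‖z‖ / ε)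
  have hn0 : (0 : ℝ) < n := (div_nonneg (norm_nonneg z) hε.le).trans_lt hn
  have hz : z / n ∈ Metric.ball 0 ε := by
    rw [mem_ball_zero_iff, norm_div, Complex.norm_natCast, div_lt_iff₀ hn0]
    rwa [div_lt_iff₀ hε, mul_comm] at hn
  have hnC : (n : ℂ) ≠ 0 := by exact_mod_cast hn0.ne'
  have h1 : Λ.proj z = n • Λ.proj (z / n) := by
    rw [← QuotientAddGroup.mk_nsmul, nsmul_eq_mul, mul_div_cancel₀ _ hnC]
  rw [h1, map_nsmul, (hball _ hz).1, hlin _ hz, ← QuotientAddGroup.mk_nsmul, nsmul_eq_mul]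
  congr 1
  field_simp

/-- Multiplication by `α` identifies `Λ_τ` with `Λ_i`, so `(α, α τ)` and `(1, i)` are bases of one
lattice. Mutually inverse integral base changes have determinant `±1`, and `τ.im > 0` fixes the
sign. -/
theorem modulus_eq_of_curveIso {τ : ℍ}
    (f : CurveIso (latticeOf τ) (latticeOf UpperHalfPlane.I)) :
    modulus τ = modulus UpperHalfPlane.I := by
  obtain ⟨α, hα⟩ := exists_mul_of_curveIso f
  have hmem (z : ℂ) : z ∈ (latticeOf τ).carrier ↔
      α * z ∈ (latticeOf UpperHalfPlane.I).carrier := by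
    rw [← QuotientAddGroup.eq_zero_iff, ← QuotientAddGroup.eq_zero_iff (α * z)]
    exact (EmbeddingLike.map_eq_zero_iff (f := f.toAddEquiv)).symm.trans
      (Eq.congr_left (hα z))
  have hα0 : α ≠ 0 := by
    rintro rfl
    -- If `α = 0`, every complex number would lie in `Λ_τ`, in particular `τ / 2`.
    obtain ⟨m, n, h⟩ := mem_latticeOf.1 ((hmem (τ / 2)).2 (by simp))
    have him := congrArg Complex.im h
    simp only [Complex.add_im, Complex.intCast_im, Complex.mul_im, Complex.intCast_re, zero_mul,
      add_zero, zero_add, Complex.div_ofNat_im] at him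
    have h2 : (2 * n : ℝ) = 1 := mul_right_cancel₀ τ.im_pos.ne' (by
      rw [← UpperHalfPlane.coe_im]
      linarith)
    have h3 : 2 * n = 1 := by exact_mod_cast h2
    omega
  obtain ⟨d, c, hdc⟩ := mem_latticeOf.1 ((hmem 1).1 (mem_latticeOf.2 ⟨1, 0, by simp⟩))
  obtain ⟨b, a, hba⟩ := mem_latticeOf.1 ((hmem τ).1 (mem_latticeOf.2 ⟨0, 1, by simp⟩))
  obtain ⟨q, p, hqp⟩ := mem_latticeOf.1 ((hmem α⁻¹).2 (mem_latticeOf.2 ⟨1, 0, by simp [hα0]⟩))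
  obtain ⟨s, r, hsr⟩ := mem_latticeOf.1 ((hmem (α⁻¹ * Complex.I)).2
    (mem_latticeOf.2 ⟨0, 1, by simp [hα0]⟩))
  rw [UpperHalfPlane.coe_I, mul_one] at hdc
  rw [UpperHalfPlane.coe_I] at hba
  have e1 : (q : ℂ) * (d + c * Complex.I) + p * (b + a * Complex.I) = 1 := by
    rw [hdc, hba]
    linear_combination α * hqp + mul_inv_cancel₀ hα0
  have e2 : (s : ℂ) * (d + c * Complex.I) + r * (b + a * Complex.I) = Complex.I := by
    rw [hdc, hba]
    linear_combination α * hsr + Complex.I * mul_inv_cancel₀ hα0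
  have e1r := congrArg Complex.re e1
  have e1i := congrArg Complex.im e1
  have e2r := congrArg Complex.re e2
  have e2i := congrArg Complex.im e2
  simp at e1r e1i e2r e2i
  norm_cast at e1r e1i e2r e2i
  have hdet : (a * d - b * c) * (q * r - p * s) = 1 := by
    linear_combination (s * c + r * a) * e1r + e2i - (s * d + r * b) * e1i
  have hτ : (τ : ℂ) = (a * Complex.I + b) / (c * Complex.I + d) := by
    rw [eq_div_iff (by rw [add_comm, hdc]; exact hα0)]
    linear_combination (τ : ℂ) * hdc - hba
  have hpos : 0 < a * d - b * c := by
    have hτα := hba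
    rw [← hdc] at hτα
    have hre := congrArg Complex.re hτα
    have him := congrArg Complex.im hτα
    simp at hre him
    have hc : 0 < (d : ℝ) ^ 2 + c ^ 2 := by
      refine (add_nonneg (sq_nonneg _) (sq_nonneg _)).lt_of_ne fun h => hα0 ?_
      have hd : (d : ℝ) = 0 := by nlinarith
      have hc : (c : ℝ) = 0 := by nlinarith
      rw [← hdc, Int.cast_eq_zero.1 hd, Int.cast_eq_zero.1 hc]
      simp
    -- This is the imaginary part of `α τ` times the conjugate of `α`, namely `|α|² τ.im`.
    have h1 : (a * d - b * c : ℝ) = (d ^ 2 + c ^ 2) * τ.im := by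
      linear_combination (d : ℝ) * him - c * hre
    have h2 := h1 ▸ mul_pos hc τ.im_pos
    exact_mod_cast h2
  have h1 : a * d - b * c = 1 := by
    rcases Int.isUnit_iff.1 (IsUnit.of_mul_eq_one _ hdet) with h | h
    · exact h
    · omega
  refine Quotient.sound ⟨⟨!![a, b; c, d], by rw [Matrix.det_fin_two_of, h1]⟩, ?_⟩
  refine UpperHalfPlane.ext ((UpperHalfPlane.coe_specialLinearGroup_apply _ _).trans ?_)
  rw [hτ]
  simp

/-! ### Families over a point and natural transformations -/

theorem EllipticFamily.continuous_fiber {U : Type} [TopologicalSpace U] (E : EllipticFamily U)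
    (u : U) : Continuous fun x : (E.lattice u).Curve => (⟨u, x⟩ : E.Total) := by
  obtain ⟨V, hu, τ, φ, hcont, -⟩ := E.locallyTrivial u
  have h : Continuous fun x : (latticeOf (τ ⟨u, hu⟩)).Curve =>
      (⟨u, φ ⟨u, hu⟩ x⟩ : E.Total) :=
    QuotientAddGroup.isOpenQuotientMap_mk.isQuotientMap.continuous_iff.2
      (hcont.comp (continuous_const.prodMk continuous_id : Continuous fun z : ℂ =>
        ((⟨u, hu⟩ : V), z)))
  have h' := h.comp (φ ⟨u, hu⟩).symm.continuous
  simpa only [Function.comp_def, CurveIso.apply_symm_apply] using h'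

/-- The local trivialization covers the whole total space and is open, so it is a quotient map
through which continuity can be tested. -/
theorem EllipticFamily.continuous_point (E : EllipticFamily PUnit) :
    Continuous (Y := (E.lattice PUnit.unit).Curve) (fun x : E.Total => x.point) := by
  obtain ⟨V, hu, τ, φ, hcont, hopen⟩ := E.locallyTrivial PUnit.unit
  have hsurj : Function.Surjective (fun x : V × ℂ =>
      (⟨x.1, φ x.1 ((latticeOf (τ x.1)).proj x.2)⟩ : E.Total)) := by
    rintro ⟨u, x⟩
    obtain ⟨z, hz⟩ := QuotientAddGroup.mk_surjective ((φ ⟨u, hu⟩).symm x)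
    refine ⟨(⟨u, hu⟩, z), congrArg (TotalSpace.mk u) ?_⟩
    exact (congrArg (φ ⟨u, hu⟩) hz).trans ((φ ⟨u, hu⟩).apply_symm_apply x)
  refine (hopen.isQuotientMap hcont hsurj).continuous_iff.2 ?_
  have h : Continuous fun x : V × ℂ =>
      φ ⟨PUnit.unit, hu⟩ ((latticeOf (τ ⟨PUnit.unit, hu⟩)).proj x.2) :=
    (φ ⟨PUnit.unit, hu⟩).continuous.comp (QuotientAddGroup.continuous_mk.comp continuous_snd)
  exact h

/-- Families over a point are determined by their fibre. -/
theorem EllipticFamily.equiv_of_curveIso {E E' : EllipticFamily PUnit}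
    (f : CurveIso (E.lattice PUnit.unit) (E'.lattice PUnit.unit)) : E ≈ E' :=
  ⟨⟨fun _ => f, (E'.continuous_fiber _).comp (f.continuous.comp E.continuous_point),
    (E.continuous_fiber _).comp (f.symm.continuous.comp E'.continuous_point)⟩⟩

/-- A natural transformation from the moduli functor to `Mor(-, M)` sends families whose fibres are
all isomorphic to that of a family `P` over a point to a constant map depending on `P` only. -/
theorem app_cls_eq_const {M : TopCat.{0}} (φ : moduliFunctor ⟶ yoneda.obj M)
    (P : EllipticFamily PUnit) {U : Type} [TopologicalSpace U] (E : EllipticFamily U)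
    (h : ∀ u, Nonempty (CurveIso (E.lattice u) (P.lattice PUnit.unit))) :
    φ.app _ E.cls = TopCat.ofHom
      (ContinuousMap.const U ((φ.app (Opposite.op (TopCat.of PUnit)) P.cls :
        TopCat.of PUnit ⟶ M).hom PUnit.unit)) := by
  refine TopCat.hom_ext (ContinuousMap.ext fun u => ?_)
  obtain ⟨f⟩ := h u
  let i : TopCat.of PUnit ⟶ TopCat.of U := TopCat.ofHom (ContinuousMap.const PUnit u)
  have hcls : moduliFunctor.map i.op E.cls = P.cls :=
    Quotient.sound (EllipticFamily.equiv_of_curveIso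
      (E := E.pullback (ContinuousMap.const PUnit u)) f)
  have hnat := NatTrans.naturality_apply φ i.op E.cls
  rw [hcls] at hnat
  exact congrArg (fun g : TopCat.of PUnit ⟶ M => g.hom PUnit.unit) hnat.symm

theorem isClassifyingMap_iff {U : Type} [TopologicalSpace U] (E : EllipticFamily U)
    (hE : ∀ u, E.lattice u = latticeOf UpperHalfPlane.I) (c : C(U, ModuliSpace)) :
    IsClassifyingMap E c ↔ c = ContinuousMap.const _ (modulus UpperHalfPlane.I) := by
  constructor
  · intro h
    ext u
    obtain ⟨τ, hc, ⟨f⟩⟩ := h u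
    rw [hE u] at f
    exact hc.trans (modulus_eq_of_curveIso f.symm)
  · rintro rfl u
    refine ⟨UpperHalfPlane.I, rfl, ?_⟩
    rw [hE u]
    exact ⟨CurveIso.refl _⟩

end EllModuli

/-! ### Non-representability -/

theorem mainTheorem3 :
    -- the moduli functor is not represented by `ℍ / PSL₂(ℤ)`
    (¬ Nonempty (EllModuli.moduliFunctor.RepresentableBy (TopCat.of EllModuli.ModuliSpace))) ∧
    -- the trivial family `E` and the twisted family `E'` over the circle
    ∃ E E' : EllModuli.EllipticFamily EllModuli.S1,
      EllModuli.IsGluedAlong (EllModuli.CurveIso.refl (EllModuli.latticeOf UpperHalfPlane.I)) E ∧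
      EllModuli.IsGluedAlong EllModuli.mulI E' ∧
      (∀ s, E.lattice s = EllModuli.latticeOf UpperHalfPlane.I ∧ E'.lattice s = EllModuli.latticeOf UpperHalfPlane.I) ∧
      -- they are not isomorphic
      IsEmpty (EllModuli.EllipticFamily.Iso E E') ∧
      -- both have the constant map with value `[i]` as their only classifying map
      (∀ c : C(EllModuli.S1, EllModuli.ModuliSpace), EllModuli.IsClassifyingMap E c ↔
        c = ContinuousMap.const _ (EllModuli.modulus UpperHalfPlane.I)) ∧
      (∀ c : C(EllModuli.S1, EllModuli.ModuliSpace), EllModuli.IsClassifyingMap E' c ↔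
        c = ContinuousMap.const _ (EllModuli.modulus UpperHalfPlane.I)) ∧
      -- any natural transformation to `Mor(-, ℍ / PSL₂(ℤ))` maps both to the same constant map
      (∀ φ : EllModuli.moduliFunctor ⟶ yoneda.obj (TopCat.of EllModuli.ModuliSpace),
        ∃ m : EllModuli.ModuliSpace,
          φ.app _ E.cls = TopCat.ofHom (ContinuousMap.const EllModuli.S1 m) ∧
          φ.app _ E'.cls = TopCat.ofHom (ContinuousMap.const EllModuli.S1 m)) := by
  let E := EllModuli.torusFamily (1 : EllModuli.CurveIso (EllModuli.latticeOf UpperHalfPlane.I) _)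
  let E' := EllModuli.torusFamily EllModuli.mulI
  have hφ (φ : EllModuli.moduliFunctor ⟶ yoneda.obj (TopCat.of EllModuli.ModuliSpace)) :
      ∃ m : EllModuli.ModuliSpace,
        φ.app _ E.cls = TopCat.ofHom (ContinuousMap.const EllModuli.S1 m) ∧
        φ.app _ E'.cls = TopCat.ofHom (ContinuousMap.const EllModuli.S1 m) := by
    -- The fibre of `E` over `0`, as a family over a point, serves for both families because all
    -- their fibres coincide.
    let P := E.pullback (ContinuousMap.const PUnit (0 : EllModuli.S1))
    exact ⟨_, EllModuli.app_cls_eq_const φ P E fun _ => ⟨EllModuli.CurveIso.refl _⟩,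
      EllModuli.app_cls_eq_const φ P E' fun _ => ⟨EllModuli.CurveIso.refl _⟩⟩
  refine ⟨?_, E, E', EllModuli.torusFamily_isGluedAlong _, EllModuli.torusFamily_isGluedAlong _,
    fun _ => ⟨rfl, rfl⟩, EllModuli.torusFamily_not_iso,
    EllModuli.isClassifyingMap_iff E fun _ => rfl,
    EllModuli.isClassifyingMap_iff E' fun _ => rfl, hφ⟩
  rintro ⟨r⟩
  let e := Functor.representableByEquiv r
  obtain ⟨m, h, h'⟩ := hφ e.inv
  have hinj : Function.Injective (e.inv.app (Opposite.op (TopCat.of EllModuli.S1))) :=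
    (e.app (Opposite.op (TopCat.of EllModuli.S1))).toEquiv.symm.injective
  obtain ⟨g⟩ := Quotient.exact (hinj (h.trans h'.symm))
  exact EllModuli.torusFamily_not_iso.false g
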